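/- **Setting.** Let $n_u,n_s,k\ge 0$ be integers, let all spaces $\mathbb R^d$ carry the Euclidean norm and all linear maps the corresponding operator norm, and put $\overline{\mathbf B}_d=\{x\in\mathbb R^d:\|x\|\le 1\}$ and $N=\overline{\mathbf B}_{n_u}\times\overline{\mathbf B}_{n_s}$ (an $h$-set written in its own coordinates $(a,b)$). Let $K\subset\mathbb R^k$ be compact, let $U\subset\mathbb R^{n_u}\times\mathbb R^{n_s}\times\mathbb R^k$ be open with $N\times K\subset U$, and let $f^a:U\to\mathbb R^{n_u}$, $f^b:U\to\mathbb R^{n_s}$ be $C^\infty$. Consider $$\dot a=f^a(a,b;\mu),\qquad \dot b=f^b(a,b;\mu),\tag{1}$$ and suppose that for every $\mu\in K$ the origin is an equilibrium of (1) and $N$ is an isolating block for (1), i.e. every point of $\partial N$ is an exit or an entrance point and the set of exit points is closed. Here $x\in\partial N$ is an exit (entrance) point if for every solution $z:[-\delta_1,\delta_2]\to\{(a,b):(a,b,\mu)\in U\}$ with $z(0)=x$, $\delta_1\ge0$, $\delta_2>0$, there are $0\le\epsilon_1\le\delta_1$ and $0<\epsilon_2\le\delta_2$ such that $z(t)\notin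 N$ (resp. $z(t)\in\operatorname{int}N$) for $0<t\le\epsilon_2$ and $z(t)\notin\partial N$ (resp. $z(t)\notin N$) for $-\epsilon_1\le t<0$. For a square matrix $A$ let $m(A)=\sup_{\|z\|=1}\|Az\|$, $l(A)=\lim_{h\to+0}\frac{\|I+hA\|-1}{h}$ and $m_l(A)=-l(-A)$ (the largest and the smallest eigenvalue of $(A+A^T)/2$; on $\mathbb R^0$, $m=0$, $l=-\infty$ and $m_l=+\infty$). Let $M>1$ and assume the *$M$-cone condition*: with suprema and infima over $N\times K$, $$\mu_s=\sup\Big\{l\big(\tfrac{\partial f^b}{\partial b}\big)+M\big\|\tfrac{\partial f^b}{\partial(a,\mu)}\big\|\Big\},\qquad \xi_u=\inf m_l\big(\tfrac{\partial f^a}{\partial a}\big)-M\sup\big\|\tfrac{\partial f^a}{\partial(b,\mu)}\big\|,$$ $$\mu_{ss}=\sup\Big\{l\big(\tfrac{\partial f^b}{\partial b}\big)+\tfrac1M\big\|\tfrac{\partial f^b}{\partial a}\big\|\Big\},\qquad \xi_{su}=\inf m_l\big(\tfrac{\partial f^a}{\partial a}\big)-\tfrac1M\sup\big\|\tfrac{\partial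 f^a}{\partial b}\big\|$$ satisfy $\mu_s<0<\xi_u$, $\mu_{ss}<\xi_u$ and $\mu_s<\xi_{su}$. Assume further that $$\mu_{s,W^s}:=\sup_{N\times K}\Big\{\tfrac{M^2+1}{M^3}\big\|\tfrac{\partial f^b}{\partial a}\big\|+\tfrac1{M^2}\,m\big(\tfrac{\partial f^b}{\partial b}\big)+l\big(\tfrac{\partial f^b}{\partial b}\big)\Big\}<0 .$$ **Proposition.** For $\mu\in K$ let $W^s_\mu$ be the local stable manifold of the origin in $N$: the set of all points of $N$ whose forward trajectory under (1) exists for all times, stays in $N$ and tends to $0$. Then for every $\mu\in K$ there is a Lipschitz function $\sigma^s_\mu:\overline{\mathbf B}_{n_s}\to\overline{\mathbf B}_{n_u}$ with $W^s_\mu=\{(\sigma^s_\mu(b),b): b\in\overline{\mathbf B}_{n_s}\}$, and $$L_s(a,b;\mu):=\|\sigma^s_\mu(b)\|^2+\|b\|^2$$ is a Lyapunov function for (1) on $W^s_\mu$: along every trajectory $z$ of (1) in $W^s_\mu$ (on a compact time interval of positive length), $\tau\mapsto L_s(z(\tau))$ is differentiable (one-sidedly at the end points), $\frac{d}{d\tau}L_s(z(\tau))\le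 0$, and $\frac{d}{d\tau}L_s(z(\tau))=0$ only if $z(\tau)=0$. Moreover $$\tfrac12\,\frac{d}{d\tau}L_s(z(\tau))\le\frac{M^2}{M^2+1}\,\mu_{s,W^s}\,L_s(z(\tau)).$$ (If $n_s=0$, then $W^s_\mu=\{0\}$ and $L_s=0$, and the right-hand side is read as $0$.) -/

import Mathlib

open Set Filter Topology
open scoped ContDiff

noncomputable section

/-- `ℝᵈ` with its Euclidean norm. -/
abbrev Eucl (d : ℕ) : Type := EuclideanSpace ℝ (Fin d)

/-! ### Logarithmic norms -/

/-- The logarithmic norm `l(A) = lim_{h → 0+} (‖I + h A‖ - 1) / h`.  The limit is taken in the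
extended reals: it is a real number as soon as `E` is nontrivial, and it is `-∞` on the
zero-dimensional space. -/
def logNorm {E : Type*} [NormedAddCommGroup E] [NormedSpace ℝ E] (A : E →L[ℝ] E) : EReal :=
  limUnder (𝓝[>] (0 : ℝ)) fun h : ℝ =>
    (((‖ContinuousLinearMap.id ℝ E + h • A‖ - 1) / h : ℝ) : EReal)

/-- The logarithmic minimum `m_l(A) = -l(-A)`; for the Euclidean norm it is the least eigenvalue
of `(A + Aᵀ) / 2` (and `+∞` on the zero-dimensional space). -/
def logMin {E : Type*} [NormedAddCommGroup E] [NormedSpace ℝ E] (A : E →L[ℝ] E) : EReal :=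
  -logNorm (-A)

/-! ### Partial derivatives of a function of `(a, b, μ)` -/

section Partial

variable {nu ns k : ℕ} {F : Type*} [NormedAddCommGroup F] [NormedSpace ℝ F]

/-- `∂g/∂a`. -/
def partialA (g : Eucl nu × Eucl ns × Eucl k → F) (p : Eucl nu × Eucl ns × Eucl k) :
    Eucl nu →L[ℝ] F :=
  fderiv ℝ (fun a => g (a, p.2.1, p.2.2)) p.1

/-- `∂g/∂b`. -/
def partialB (g : Eucl nu × Eucl ns × Eucl k → F) (p : Eucl nu × Eucl ns × Eucl k) :
    Eucl ns →L[ℝ] F :=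
  fderiv ℝ (fun b => g (p.1, b, p.2.2)) p.2.1

/-- `∂g/∂(a, μ)`, where the space of pairs `(a, μ)` carries the Euclidean norm. -/
def partialAMu (g : Eucl nu × Eucl ns × Eucl k → F) (p : Eucl nu × Eucl ns × Eucl k) :
    WithLp 2 (Eucl nu × Eucl k) →L[ℝ] F :=
  fderiv ℝ (fun w : WithLp 2 (Eucl nu × Eucl k) => g (w.fst, p.2.1, w.snd))
    (WithLp.toLp 2 (p.1, p.2.2))

/-- `∂g/∂(b, μ)`, where the space of pairs `(b, μ)` carries the Euclidean norm. -/
def partialBMu (g : Eucl nu × Eucl ns × Eucl k → F) (p : Eucl nu × Eucl ns × Eucl k) :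
    WithLp 2 (Eucl ns × Eucl k) →L[ℝ] F :=
  fderiv ℝ (fun w : WithLp 2 (Eucl ns × Eucl k) => g (p.1, w.fst, w.snd))
    (WithLp.toLp 2 (p.2.1, p.2.2))

end Partial

/-! ### The h-set in its coordinates, and the cone condition -/

/-- The h-set `N`, in the coordinates `(a, b)`: the product of the closed unit balls. -/
def hset (nu ns : ℕ) : Set (Eucl nu × Eucl ns) :=
  Metric.closedBall 0 1 ×ˢ Metric.closedBall 0 1

/-- `N × K`, as a set of triples `(a, b, μ)`. -/
def hsetParam (nu ns : ℕ) {k : ℕ} (K : Set (Eucl k)) : Set (Eucl nu × Eucl ns × Eucl k) :=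
  {p | (p.1, p.2.1) ∈ hset nu ns ∧ p.2.2 ∈ K}

section Rates

variable {nu ns k : ℕ}

/-- `μ_s = sup_{N × K} ( l(∂f^b/∂b) + M ‖∂f^b/∂(a, μ)‖ )`. -/
def rateS (fb : Eucl nu × Eucl ns × Eucl k → Eucl ns) (K : Set (Eucl k)) (M : ℝ) : EReal :=
  ⨆ p ∈ hsetParam nu ns K, (logNorm (partialB fb p) + ((M * ‖partialAMu fb p‖ : ℝ) : EReal))

/-- `ξ_u = inf_{N × K} m_l(∂f^a/∂a) - M sup_{N × K} ‖∂f^a/∂(b, μ)‖`. -/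
def rateU (fa : Eucl nu × Eucl ns × Eucl k → Eucl nu) (K : Set (Eucl k)) (M : ℝ) : EReal :=
  (⨅ p ∈ hsetParam nu ns K, logMin (partialA fa p)) -
    (M : EReal) * ⨆ p ∈ hsetParam nu ns K, ((‖partialBMu fa p‖ : ℝ) : EReal)

/-- `μ_ss = sup_{N × K} ( l(∂f^b/∂b) + (1/M) ‖∂f^b/∂a‖ )`. -/
def rateSS (fb : Eucl nu × Eucl ns × Eucl k → Eucl ns) (K : Set (Eucl k)) (M : ℝ) : EReal :=
  ⨆ p ∈ hsetParam nu ns K, (logNorm (partialB fb p) + ((1 / M * ‖partialA fb p‖ : ℝ) : EReal))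

/-- `ξ_su = inf_{N × K} m_l(∂f^a/∂a) - (1/M) sup_{N × K} ‖∂f^a/∂b‖`. -/
def rateSU (fa : Eucl nu × Eucl ns × Eucl k → Eucl nu) (K : Set (Eucl k)) (M : ℝ) : EReal :=
  (⨅ p ∈ hsetParam nu ns K, logMin (partialA fa p)) -
    ((1 / M : ℝ) : EReal) * ⨆ p ∈ hsetParam nu ns K, ((‖partialB fa p‖ : ℝ) : EReal)

/-- The `M`-cone condition for `(f^a, f^b)` in `N × K`, where `M > 1`. -/
structure ConeCondition (fa : Eucl nu × Eucl ns × Eucl k → Eucl nu)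
    (fb : Eucl nu × Eucl ns × Eucl k → Eucl ns) (K : Set (Eucl k)) (M : ℝ) : Prop where
  one_lt : 1 < M
  rateS_neg : rateS fb K M < 0
  rateU_pos : 0 < rateU fa K M
  rateSS_lt : rateSS fb K M < rateU fa K M
  rateS_lt : rateS fb K M < rateSU fa K M

/-- `μ_{s,W^s} = sup_{N × K} ( (M²+1)/M³ ‖∂f^b/∂a‖ + (1/M²) m(∂f^b/∂b) + l(∂f^b/∂b) )`, where
`m(A) = sup_{‖z‖ = 1} ‖A z‖` is the operator norm. -/
def rateSW (fb : Eucl nu × Eucl ns × Eucl k → Eucl ns) (K : Set (Eucl k)) (M : ℝ) : EReal :=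
  ⨆ p ∈ hsetParam nu ns K,
    ((((M ^ 2 + 1) / M ^ 3 * ‖partialA fb p‖ + 1 / M ^ 2 * ‖partialB fb p‖ : ℝ) : EReal) +
      logNorm (partialB fb p))

end Rates

/-! ### Solutions, isolating blocks, stable manifolds, Lyapunov functions -/

section Dynamics

variable {E : Type*} [NormedAddCommGroup E] [NormedSpace ℝ E]

/-- `z` is a solution of `z' = v(z)` on the time interval `I` with values in `S`
(with one-sided derivatives at the end points of `I`). -/
def IsSolutionOn (v : E → E) (S : Set E) (I : Set ℝ) (z : ℝ → E) : Prop :=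
  ∀ t ∈ I, z t ∈ S ∧ HasDerivWithinAt z (v (z t)) I t

/-- The exit of `N`, for the vector field `v` on the domain `D`. -/
def exitSet (v : E → E) (D N : Set E) : Set E :=
  {x | x ∈ frontier N ∧ ∀ (z : ℝ → E) (δ₁ δ₂ : ℝ), 0 ≤ δ₁ → 0 < δ₂ →
    IsSolutionOn v D (Icc (-δ₁) δ₂) z → z 0 = x →
    ∃ ε₁ ε₂ : ℝ, 0 ≤ ε₁ ∧ ε₁ ≤ δ₁ ∧ 0 < ε₂ ∧ ε₂ ≤ δ₂ ∧
      (∀ t, 0 < t → t ≤ ε₂ → z t ∉ N) ∧ (∀ t, -ε₁ ≤ t → t < 0 → z t ∉ frontier N)}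

/-- The entrance of `N`, for the vector field `v` on the domain `D`. -/
def entranceSet (v : E → E) (D N : Set E) : Set E :=
  {x | x ∈ frontier N ∧ ∀ (z : ℝ → E) (δ₁ δ₂ : ℝ), 0 ≤ δ₁ → 0 < δ₂ →
    IsSolutionOn v D (Icc (-δ₁) δ₂) z → z 0 = x →
    ∃ ε₁ ε₂ : ℝ, 0 ≤ ε₁ ∧ ε₁ ≤ δ₁ ∧ 0 < ε₂ ∧ ε₂ ≤ δ₂ ∧
      (∀ t, 0 < t → t ≤ ε₂ → z t ∈ interior N) ∧ (∀ t, -ε₁ ≤ t → t < 0 → z t ∉ N)}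

/-- `N` is an isolating block: a compact set whose boundary consists of exit and entrance points,
the exit being closed. -/
structure IsIsolatingBlock (v : E → E) (D N : Set E) : Prop where
  isCompact : IsCompact N
  frontier_eq : frontier N = exitSet v D N ∪ entranceSet v D N
  isClosed_exit : IsClosed (exitSet v D N)

/-- The (local) stable manifold of the equilibrium `x` in `N`: the points of `N` whose forward
trajectory exists for all times, stays in `N` and tends to `x`. -/
def stableManifold (v : E → E) (N : Set E) (x : E) : Set E :=
  {y | ∃ z : ℝ → E, z 0 = y ∧ IsSolutionOn v N (Ici 0) z ∧ Tendsto z atTop (𝓝 x)}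

/-- `L` is a Lyapunov function for `z' = v(z)` on `S`, relative to the equilibrium `x`: along every
trajectory in `S`, `L` is differentiable in time (one-sidedly at the end points of the time
interval, where the trajectory may leave `S`) with derivative `≤ 0`, and the derivative vanishes
only at `x`. -/
def IsLyapunovOn (v : E → E) (L : E → ℝ) (S : Set E) (x : E) : Prop :=
  ∀ (t₁ t₂ : ℝ) (z : ℝ → E), t₁ < t₂ → IsSolutionOn v S (Icc t₁ t₂) z →
    ∀ t ∈ Icc t₁ t₂, ∃ d : ℝ,
      HasDerivWithinAt (fun s => L (z s)) d (Icc t₁ t₂) t ∧ d ≤ 0 ∧ (d = 0 → z t = x)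

/-- Decay of `L` along the trajectories in `S`:  `(1/2) dL/dt ≤ c L`. -/
def DecaysOn (v : E → E) (L : E → ℝ) (S : Set E) (c : ℝ) : Prop :=
  ∀ (t₁ t₂ : ℝ) (z : ℝ → E), t₁ < t₂ → IsSolutionOn v S (Icc t₁ t₂) z →
    ∀ t ∈ Icc t₁ t₂, ∃ d : ℝ,
      HasDerivWithinAt (fun s => L (z s)) d (Icc t₁ t₂) t ∧ 1 / 2 * d ≤ c * L (z t)

end Dynamics

/-- The vector field `(a, b) ↦ (f^a(a, b; μ), f^b(a, b; μ))` at the parameter `μ`. -/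
def fieldAt {nu ns k : ℕ} (fa : Eucl nu × Eucl ns × Eucl k → Eucl nu)
    (fb : Eucl nu × Eucl ns × Eucl k → Eucl ns) (μ : Eucl k) (z : Eucl nu × Eucl ns) :
    Eucl nu × Eucl ns :=
  (fa (z.1, z.2, μ), fb (z.1, z.2, μ))

/-- `L_s(a, b) = ‖σ(b)‖² + ‖b‖²`. -/
def lyapS {nu ns : ℕ} (σ : Eucl ns → Eucl nu) (z : Eucl nu × Eucl ns) : ℝ :=
  ‖σ z.2‖ ^ 2 + ‖z.2‖ ^ 2

end

noncomputable section

/-! ### Quadratic forms and the logarithmic norm -/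

theorem logNorm_quotient_monotoneOn {E : Type*} [NormedAddCommGroup E] [NormedSpace ℝ E]
    (A : E →L[ℝ] E) :
    MonotoneOn (fun h : ℝ =>
      (((‖ContinuousLinearMap.id ℝ E + h • A‖ - 1) / h : ℝ) : EReal)) (Ioi 0) := by
  intro x hx y hy hxy
  simp only [mem_Ioi] at hx hy
  refine EReal.coe_le_coe_iff.2 ?_
  have hdec : ContinuousLinearMap.id ℝ E + x • A =
      (1 - x / y) • ContinuousLinearMap.id ℝ E +
        (x / y) • (ContinuousLinearMap.id ℝ E + y • A) := by
    rw [smul_add, smul_smul, div_mul_cancel₀ _ hy.ne', ← add_assoc, ← add_smul]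
    simp
  have hq : x / y ≤ 1 := (div_le_one hy).2 hxy
  have hn : ‖ContinuousLinearMap.id ℝ E + x • A‖ ≤
      (1 - x / y) + (x / y) * ‖ContinuousLinearMap.id ℝ E + y • A‖ := by
    rw [hdec]
    refine (norm_add_le _ _).trans ?_
    rw [norm_smul, norm_smul, Real.norm_of_nonneg (sub_nonneg.2 hq),
      Real.norm_of_nonneg (by positivity)]
    have := ContinuousLinearMap.norm_id_le (𝕜 := ℝ) (E := E)
    have := mul_le_mul_of_nonneg_left this (sub_nonneg.2 hq)
    linarith
  rw [div_le_iff₀ hx]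
  calc ‖ContinuousLinearMap.id ℝ E + x • A‖ - 1
      ≤ (1 - x / y) + (x / y) * ‖ContinuousLinearMap.id ℝ E + y • A‖ - 1 := by linarith
    _ = (‖ContinuousLinearMap.id ℝ E + y • A‖ - 1) / y * x := by ring

theorem tendsto_logNorm {E : Type*} [NormedAddCommGroup E] [NormedSpace ℝ E] (A : E →L[ℝ] E) :
    Tendsto (fun h : ℝ => (((‖ContinuousLinearMap.id ℝ E + h • A‖ - 1) / h : ℝ) : EReal))
      (𝓝[>] (0 : ℝ)) (𝓝 (logNorm A)) :=
  tendsto_nhds_limUnder ⟨_, (logNorm_quotient_monotoneOn A).tendsto_nhdsGT (OrderBot.bddBelow _)⟩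

section Inner

variable {E : Type*} [NormedAddCommGroup E] [InnerProductSpace ℝ E]

theorem inner_le_of_logNorm_le {A : E →L[ℝ] E} {c : ℝ} (h : logNorm A ≤ c) (x : E) :
    inner ℝ x (A x) ≤ c * ‖x‖ ^ 2 := by
  rcases eq_or_ne x 0 with rfl | hx
  · simp
  have hx0 : 0 < ‖x‖ := norm_pos_iff.2 hx
  have hle : ((inner ℝ x (A x) / ‖x‖ ^ 2 : ℝ) : EReal) ≤ logNorm A := by
    refine ge_of_tendsto (tendsto_logNorm A) ?_
    filter_upwards [self_mem_nhdsWithin] with t ht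
    simp only [mem_Ioi] at ht
    refine EReal.coe_le_coe_iff.2 ?_
    rw [div_le_div_iff₀ (by positivity) ht]
    have h1 : inner ℝ x ((ContinuousLinearMap.id ℝ E + t • A) x) ≤
        ‖x‖ * (‖ContinuousLinearMap.id ℝ E + t • A‖ * ‖x‖) :=
      (real_inner_le_norm _ _).trans
        (mul_le_mul_of_nonneg_left (ContinuousLinearMap.le_opNorm _ _) hx0.le)
    simp only [add_apply, smul_apply,
      ContinuousLinearMap.id_apply, inner_add_right, inner_smul_right,
      real_inner_self_eq_norm_sq] at h1
    nlinarith
  have := EReal.coe_le_coe_iff.1 (hle.trans h)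
  rwa [div_le_iff₀ (by positivity)] at this

theorem le_inner_of_le_logMin {A : E →L[ℝ] E} {c : ℝ} (h : (c : EReal) ≤ logMin A) (x : E) :
    c * ‖x‖ ^ 2 ≤ inner ℝ x (A x) := by
  have h1 : logNorm (-A) ≤ ((-c : ℝ) : EReal) := by
    rw [EReal.coe_neg]
    exact EReal.le_neg.1 h
  have := inner_le_of_logNorm_le h1 x
  simp only [neg_apply, inner_neg_right] at this
  linarith

end Inner

/-! ### Partial derivatives -/

theorem fderiv_comp_apply_of_hasFDerivAt {W E F : Type*} [NormedAddCommGroup W] [NormedSpace ℝ W]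
    [NormedAddCommGroup E] [NormedSpace ℝ E] [NormedAddCommGroup F] [NormedSpace ℝ F]
    {g : E → F} {m : W → E} {i : W →L[ℝ] E} {w : W} {p : E} (hg : DifferentiableAt ℝ g p)
    (hp : m w = p) (hm : HasFDerivAt m i w) (v : W) :
    fderiv ℝ (fun w => g (m w)) w v = fderiv ℝ g p (i v) := by
  subst hp
  have := (hg.hasFDerivAt.comp w hm).fderiv
  simp only [Function.comp_def] at this
  rw [this]
  rfl

theorem hasFDerivAt_withLp_fst {X Y : Type*} [NormedAddCommGroup X] [NormedSpace ℝ X]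
    [NormedAddCommGroup Y] [NormedSpace ℝ Y] (w : WithLp 2 (X × Y)) :
    HasFDerivAt (fun w : WithLp 2 (X × Y) => w.fst)
      ((ContinuousLinearMap.fst ℝ X Y).comp
        (WithLp.prodContinuousLinearEquiv 2 ℝ X Y).toContinuousLinearMap) w :=
  ((ContinuousLinearMap.fst ℝ X Y).comp
    (WithLp.prodContinuousLinearEquiv 2 ℝ X Y).toContinuousLinearMap).hasFDerivAt

theorem hasFDerivAt_withLp_snd {X Y : Type*} [NormedAddCommGroup X] [NormedSpace ℝ X]
    [NormedAddCommGroup Y] [NormedSpace ℝ Y] (w : WithLp 2 (X × Y)) :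
    HasFDerivAt (fun w : WithLp 2 (X × Y) => w.snd)
      ((ContinuousLinearMap.snd ℝ X Y).comp
        (WithLp.prodContinuousLinearEquiv 2 ℝ X Y).toContinuousLinearMap) w :=
  ((ContinuousLinearMap.snd ℝ X Y).comp
    (WithLp.prodContinuousLinearEquiv 2 ℝ X Y).toContinuousLinearMap).hasFDerivAt

section PartialDeriv

variable {nu ns k : ℕ} {F : Type*} [NormedAddCommGroup F] [NormedSpace ℝ F]
  {g : Eucl nu × Eucl ns × Eucl k → F} {p : Eucl nu × Eucl ns × Eucl k}

theorem partialA_apply (hg : DifferentiableAt ℝ g p) (v : Eucl nu) :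
    partialA g p v = fderiv ℝ g p (v, 0, 0) :=
  fderiv_comp_apply_of_hasFDerivAt hg rfl
    ((hasFDerivAt_id _).prodMk ((hasFDerivAt_const _ _).prodMk (hasFDerivAt_const _ _))) v

theorem partialB_apply (hg : DifferentiableAt ℝ g p) (v : Eucl ns) :
    partialB g p v = fderiv ℝ g p (0, v, 0) :=
  fderiv_comp_apply_of_hasFDerivAt hg rfl
    ((hasFDerivAt_const _ _).prodMk ((hasFDerivAt_id _).prodMk (hasFDerivAt_const _ _))) v

theorem partialAMu_apply (hg : DifferentiableAt ℝ g p) (v : Eucl nu) :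
    partialAMu g p (WithLp.toLp 2 (v, 0)) = fderiv ℝ g p (v, 0, 0) := by
  have h := (hasFDerivAt_withLp_fst (WithLp.toLp 2 (p.1, p.2.2))).prodMk
      ((hasFDerivAt_const p.2.1 (WithLp.toLp 2 (p.1, p.2.2))).prodMk
        (hasFDerivAt_withLp_snd (WithLp.toLp 2 (p.1, p.2.2))))
  exact fderiv_comp_apply_of_hasFDerivAt hg rfl h (WithLp.toLp 2 (v, 0))

theorem partialBMu_apply (hg : DifferentiableAt ℝ g p) (v : Eucl ns) :
    partialBMu g p (WithLp.toLp 2 (v, 0)) = fderiv ℝ g p (0, v, 0) := by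
  have h := (hasFDerivAt_const p.1 (WithLp.toLp 2 (p.2.1, p.2.2))).prodMk
      ((hasFDerivAt_withLp_fst (WithLp.toLp 2 (p.2.1, p.2.2))).prodMk
        (hasFDerivAt_withLp_snd (WithLp.toLp 2 (p.2.1, p.2.2))))
  exact fderiv_comp_apply_of_hasFDerivAt hg rfl h (WithLp.toLp 2 (v, 0))

theorem fderiv_apply_eq_partial (hg : DifferentiableAt ℝ g p) (v : Eucl nu) (w : Eucl ns) :
    fderiv ℝ g p (v, w, 0) = partialA g p v + partialB g p w := by
  rw [partialA_apply hg, partialB_apply hg, ← map_add]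
  simp

theorem norm_partialA_le (hg : DifferentiableAt ℝ g p) : ‖partialA g p‖ ≤ ‖partialAMu g p‖ := by
  refine ContinuousLinearMap.opNorm_le_bound _ (norm_nonneg _) fun v => ?_
  rw [partialA_apply hg, ← partialAMu_apply hg]
  refine (ContinuousLinearMap.le_opNorm _ _).trans_eq ?_
  simp

theorem norm_partialB_le (hg : DifferentiableAt ℝ g p) : ‖partialB g p‖ ≤ ‖partialBMu g p‖ := by
  refine ContinuousLinearMap.opNorm_le_bound _ (norm_nonneg _) fun v => ?_
  rw [partialB_apply hg, ← partialBMu_apply hg]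
  refine (ContinuousLinearMap.le_opNorm _ _).trans_eq ?_
  simp

end PartialDeriv

/-! ### Vector fields satisfying two-point cone estimates -/

/-- The product of the closed unit balls. -/
abbrev unitBlock (A B : Type*) [NormedAddCommGroup A] [NormedAddCommGroup B] : Set (A × B) :=
  Metric.closedBall 0 1 ×ˢ Metric.closedBall 0 1

/-- A Lipschitz vector field on the product of the unit balls, vanishing at the origin, which
expands differences in the first variable and contracts differences in the second one on
overlapping cones of aperture `M`. -/
structure ConeField {A B : Type*} [NormedAddCommGroup A] [InnerProductSpace ℝ A]
    [NormedAddCommGroup B] [InnerProductSpace ℝ B] (f : A × B → A × B) (M α β c : ℝ)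
    (L : NNReal) : Prop where
  one_lt : 1 < M
  zero : f 0 = 0
  lip : LipschitzOnWith L f (unitBlock A B)
  nonneg : 0 ≤ β
  gap : M * β < α
  neg : c < 0
  expand : ∀ x ∈ unitBlock A B, ∀ y ∈ unitBlock A B,
    α * ‖x.1 - y.1‖ ^ 2 - β * ‖x.1 - y.1‖ * ‖x.2 - y.2‖ ≤
      inner ℝ (x.1 - y.1) ((f x).1 - (f y).1)
  contract : ∀ x ∈ unitBlock A B, ∀ y ∈ unitBlock A B, ‖x.1 - y.1‖ ≤ M * ‖x.2 - y.2‖ →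
    inner ℝ (x.2 - y.2) ((f x).2 - (f y).2) ≤ c * ‖x.2 - y.2‖ ^ 2

section FieldEstimates

variable {nu ns k : ℕ} {U : Set (Eucl nu × Eucl ns × Eucl k)} {K : Set (Eucl k)}
  {fa : Eucl nu × Eucl ns × Eucl k → Eucl nu} {fb : Eucl nu × Eucl ns × Eucl k → Eucl ns}
  {M : ℝ} {μ : Eucl k}

theorem convex_hset : Convex ℝ (hset nu ns) :=
  (convex_closedBall 0 1).prod (convex_closedBall 0 1)

theorem zero_mem_hset : (0 : Eucl nu × Eucl ns) ∈ hset nu ns := by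
  simp [hset]

theorem exists_inner_sub_eq_partial {F : Type*} [NormedAddCommGroup F] [InnerProductSpace ℝ F]
    {g : Eucl nu × Eucl ns × Eucl k → F} (hg : ∀ p ∈ hsetParam nu ns K, DifferentiableAt ℝ g p)
    (hμ : μ ∈ K) {x y : Eucl nu × Eucl ns} (hx : x ∈ hset nu ns) (hy : y ∈ hset nu ns) (w : F) :
    ∃ p ∈ hsetParam nu ns K, inner ℝ w (g (x.1, x.2, μ) - g (y.1, y.2, μ)) =
      inner ℝ w (partialA g p (x.1 - y.1)) + inner ℝ w (partialB g p (x.2 - y.2)) := by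
  set q : ℝ → Eucl nu × Eucl ns × Eucl k :=
    fun s => (y.1 + s • (x.1 - y.1), y.2 + s • (x.2 - y.2), μ) with hq
  have hmem : ∀ s ∈ Icc (0 : ℝ) 1, q s ∈ hsetParam nu ns K := fun s hs =>
    ⟨convex_hset.add_smul_sub_mem hy hx hs, hμ⟩
  have hqd : ∀ s, HasDerivAt q (x.1 - y.1, x.2 - y.2, 0) s := by
    intro s
    refine HasDerivAt.prodMk ?_ (HasDerivAt.prodMk ?_ (hasDerivAt_const _ _))
    · simpa using ((hasDerivAt_id s).smul_const (x.1 - y.1)).const_add y.1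
    · simpa using ((hasDerivAt_id s).smul_const (x.2 - y.2)).const_add y.2
  have hd : ∀ s ∈ Icc (0 : ℝ) 1, HasDerivAt (fun s => inner ℝ w (g (q s)))
      (inner ℝ w (fderiv ℝ g (q s) (x.1 - y.1, x.2 - y.2, 0))) s := by
    intro s hs
    have h1 := (hg _ (hmem s hs)).hasFDerivAt.comp_hasDerivAt s (hqd s)
    simpa using (hasDerivAt_const s w).inner ℝ h1
  obtain ⟨s, hs, hs'⟩ := exists_hasDerivAt_eq_slope _ _ (zero_lt_one' ℝ)
    (fun s hs => (hd s hs).continuousAt.continuousWithinAt)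
    (fun s hs => hd s (Ioo_subset_Icc_self hs))
  have hs0 := hmem s (Ioo_subset_Icc_self hs)
  refine ⟨q s, hs0, ?_⟩
  rw [← inner_add_right, ← fderiv_apply_eq_partial (hg _ hs0), hs', inner_sub_right]
  simp [hq]

theorem ConeCondition.exists_rateS_bound (h : ConeCondition fa fb K M) :
    ∃ c : ℝ, c < 0 ∧ ∀ p ∈ hsetParam nu ns K,
      logNorm (partialB fb p) ≤ ((c - M * ‖partialAMu fb p‖ : ℝ) : EReal) := by
  obtain ⟨c, hc1, hc2⟩ := EReal.lt_iff_exists_real_btwn.1 h.rateS_neg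
  refine ⟨c, by exact_mod_cast hc2, fun p hp => ?_⟩
  rw [EReal.coe_sub, EReal.le_sub_iff_add_le (by simp) (by simp)]
  exact (le_iSup₂ (f := fun p (_ : p ∈ hsetParam nu ns K) =>
    logNorm (partialB fb p) + ((M * ‖partialAMu fb p‖ : ℝ) : EReal)) p hp).trans hc1.le

theorem ConeCondition.exists_rateU_bound (h : ConeCondition fa fb K M)
    (hne : (hsetParam nu ns K).Nonempty) :
    ∃ α β : ℝ, 0 ≤ β ∧ M * β < α ∧ ∀ p ∈ hsetParam nu ns K,
      (α : EReal) ≤ logMin (partialA fa p) ∧ ‖partialBMu fa p‖ ≤ β := by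
  obtain ⟨p₀, hp₀⟩ := hne
  have hM : 0 < M := zero_lt_one.trans h.one_lt
  have hpos := h.rateU_pos
  rw [rateU] at hpos
  have hle : ∀ p ∈ hsetParam nu ns K, ((‖partialBMu fa p‖ : ℝ) : EReal) ≤
      ⨆ p ∈ hsetParam nu ns K, ((‖partialBMu fa p‖ : ℝ) : EReal) := fun p hp =>
    le_iSup₂ (f := fun p (_ : p ∈ hsetParam nu ns K) => ((‖partialBMu fa p‖ : ℝ) : EReal)) p hp
  have hge : ∀ p ∈ hsetParam nu ns K, (⨅ p ∈ hsetParam nu ns K, logMin (partialA fa p)) ≤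
      logMin (partialA fa p) := fun p hp =>
    iInf₂_le (f := fun p (_ : p ∈ hsetParam nu ns K) => logMin (partialA fa p)) p hp
  generalize (⨆ p ∈ hsetParam nu ns K, ((‖partialBMu fa p‖ : ℝ) : EReal)) = b at hpos hle
  generalize (⨅ p ∈ hsetParam nu ns K, logMin (partialA fa p)) = a at hpos hge
  induction b with
  | bot => exact absurd (hle p₀ hp₀) (by simp)
  | top =>
    rw [EReal.coe_mul_top_of_pos hM, EReal.sub_top] at hpos
    exact absurd hpos (by simp)
  | coe β =>
    rw [← EReal.coe_mul] at hpos
    have hlt : ((M * β : ℝ) : EReal) < a := by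
      by_contra hcon
      exact absurd hpos (not_lt.2 (EReal.sub_nonpos.2 (not_lt.1 hcon)))
    obtain ⟨α, hα1, hα2⟩ := EReal.lt_iff_exists_real_btwn.1 hlt
    refine ⟨α, β, (norm_nonneg _).trans (EReal.coe_le_coe_iff.1 (hle p₀ hp₀)),
      by exact_mod_cast hα1, fun p hp => ⟨hα2.le.trans (hge p hp), ?_⟩⟩
    exact_mod_cast hle p hp

theorem ConeCondition.exists_coneField (hU : IsOpen U) (hfa : ContDiffOn ℝ ∞ fa U)
    (hfb : ContDiffOn ℝ ∞ fb U) (hNK : hsetParam nu ns K ⊆ U) (hμ : μ ∈ K)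
    (heq : fieldAt fa fb μ 0 = 0) (h : ConeCondition fa fb K M) :
    ∃ α β c L, ConeField (fieldAt fa fb μ) M α β c L := by
  have hda : ∀ p ∈ hsetParam nu ns K, DifferentiableAt ℝ fa p := fun p hp =>
    (hfa.contDiffAt (hU.mem_nhds (hNK hp))).differentiableAt (by simp)
  have hdb : ∀ p ∈ hsetParam nu ns K, DifferentiableAt ℝ fb p := fun p hp =>
    (hfb.contDiffAt (hU.mem_nhds (hNK hp))).differentiableAt (by simp)
  obtain ⟨c, hc, hcb⟩ := h.exists_rateS_bound
  obtain ⟨α, β, hβ, hαβ, hab⟩ := h.exists_rateU_bound ⟨(0, 0, μ), zero_mem_hset, hμ⟩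
  obtain ⟨L, hL⟩ : ∃ L, LipschitzOnWith L (fieldAt fa fb μ) (unitBlock (Eucl nu) (Eucl ns)) := by
    have hi : ContDiff ℝ ∞ (fun z : Eucl nu × Eucl ns => (z.1, z.2, μ)) := by fun_prop
    have hm : MapsTo (fun z : Eucl nu × Eucl ns => (z.1, z.2, μ)) (hset nu ns) U :=
      fun z hz => hNK ⟨hz, hμ⟩
    have hcd : ContDiffOn ℝ ∞ (fieldAt fa fb μ) (hset nu ns) :=
      (hfa.comp hi.contDiffOn hm).prodMk (hfb.comp hi.contDiffOn hm)
    exact hcd.exists_lipschitzOnWith (by simp) convex_hset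
      ((isCompact_closedBall _ _).prod (isCompact_closedBall _ _))
  refine ⟨α, β, c, L, h.one_lt, heq, hL, hβ, hαβ, hc, fun x hx y hy => ?_, fun x hx y hy hxy => ?_⟩
  · obtain ⟨p, hp, hpe⟩ := exists_inner_sub_eq_partial hda hμ hx hy (x.1 - y.1)
    refine le_of_le_of_eq ?_ hpe.symm
    have h1 := le_inner_of_le_logMin (hab p hp).1 (x.1 - y.1)
    have h2 : -(‖x.1 - y.1‖ * (β * ‖x.2 - y.2‖)) ≤
        inner ℝ (x.1 - y.1) (partialB fa p (x.2 - y.2)) := by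
      refine neg_le_of_abs_le ((abs_real_inner_le_norm _ _).trans ?_)
      gcongr
      exact ContinuousLinearMap.le_of_opNorm_le _
        ((norm_partialB_le (hda p hp)).trans (hab p hp).2) _
    linarith
  · obtain ⟨p, hp, hpe⟩ := exists_inner_sub_eq_partial hdb hμ hx hy (x.2 - y.2)
    refine hpe.trans_le ?_
    have h1 := inner_le_of_logNorm_le (hcb p hp) (x.2 - y.2)
    have h2 : inner ℝ (x.2 - y.2) (partialA fb p (x.1 - y.1)) ≤
        ‖x.2 - y.2‖ * (‖partialAMu fb p‖ * (M * ‖x.2 - y.2‖)) := by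
      refine (real_inner_le_norm _ _).trans ?_
      gcongr
      refine (ContinuousLinearMap.le_of_opNorm_le _ (norm_partialA_le (hdb p hp)) _).trans ?_
      gcongr
    linarith

theorem inner_add_inner_le_of_rateSW_le (hdb : ∀ p ∈ hsetParam nu ns K, DifferentiableAt ℝ fb p)
    (hμ : μ ∈ K) (heq : fieldAt fa fb μ 0 = 0) (hM : 0 < M) {C : ℝ} (hC : rateSW fb K M ≤ C)
    {z : Eucl nu × Eucl ns} (hz : z ∈ hset nu ns) (hz' : M * ‖z.1‖ ≤ ‖z.2‖) {w : Eucl ns}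
    (hw : ‖w‖ ≤ ‖z.2‖) :
    inner ℝ z.2 (fieldAt fa fb μ z).2 + 1 / M ^ 2 * inner ℝ w (fieldAt fa fb μ z).2 ≤
      C * ‖z.2‖ ^ 2 := by
  obtain ⟨p, hp, hpe⟩ := exists_inner_sub_eq_partial hdb hμ hz zero_mem_hset
    (z.2 + (1 / M ^ 2) • w)
  have h0 : fb ((0 : Eucl nu × Eucl ns).1, (0 : Eucl nu × Eucl ns).2, μ) = 0 :=
    congrArg Prod.snd heq
  have hlog : logNorm (partialB fb p) ≤
      ((C - ((M ^ 2 + 1) / M ^ 3 * ‖partialA fb p‖ + 1 / M ^ 2 * ‖partialB fb p‖) : ℝ) :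
        EReal) := by
    rw [EReal.coe_sub, EReal.le_sub_iff_add_le (by simp) (by simp), add_comm]
    exact (le_iSup₂ (f := fun p (_ : p ∈ hsetParam nu ns K) =>
      ((((M ^ 2 + 1) / M ^ 3 * ‖partialA fb p‖ + 1 / M ^ 2 * ‖partialB fb p‖ : ℝ) : EReal) +
      logNorm (partialB fb p))) p hp).trans hC
  have h1 := inner_le_of_logNorm_le hlog z.2
  rw [h0] at hpe
  simp only [Prod.fst_zero, Prod.snd_zero, sub_zero, inner_add_left, inner_smul_left,
    RCLike.conj_to_real] at hpe
  have hy : ‖z.1‖ ≤ ‖z.2‖ / M := by rw [le_div_iff₀ hM]; linarith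
  have hA : ‖partialA fb p z.1‖ ≤ ‖partialA fb p‖ * (‖z.2‖ / M) :=
    (ContinuousLinearMap.le_opNorm _ _).trans (by gcongr)
  have h2 : inner ℝ z.2 (partialA fb p z.1) ≤ ‖z.2‖ * (‖partialA fb p‖ * (‖z.2‖ / M)) :=
    (real_inner_le_norm _ _).trans (by gcongr)
  have h3 : inner ℝ w (partialA fb p z.1) ≤ ‖z.2‖ * (‖partialA fb p‖ * (‖z.2‖ / M)) :=
    (real_inner_le_norm _ _).trans (by gcongr)
  have h4 : inner ℝ w (partialB fb p z.2) ≤ ‖z.2‖ * (‖partialB fb p‖ * ‖z.2‖) :=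
    (real_inner_le_norm _ _).trans (by gcongr; exact ContinuousLinearMap.le_opNorm _ _)
  have hM2 : 0 ≤ 1 / M ^ 2 := by positivity
  refine (show _ = _ from hpe).trans_le ?_
  have h34 := mul_le_mul_of_nonneg_left (add_le_add h3 h4) hM2
  have hid : C * ‖z.2‖ ^ 2 = ‖z.2‖ * (‖partialA fb p‖ * (‖z.2‖ / M)) +
      (C - ((M ^ 2 + 1) / M ^ 3 * ‖partialA fb p‖ + 1 / M ^ 2 * ‖partialB fb p‖)) * ‖z.2‖ ^ 2 +
      1 / M ^ 2 * (‖z.2‖ * (‖partialA fb p‖ * (‖z.2‖ / M)) +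
        ‖z.2‖ * (‖partialB fb p‖ * ‖z.2‖)) := by
    field_simp
    ring
  linarith

end FieldEstimates

/-! ### A comparison lemma -/

theorem nonneg_of_mul_le_deriv {u u' : ℝ → ℝ} {T K : ℝ}
    (hu : ∀ t ∈ Icc 0 T, HasDerivWithinAt u (u' t) (Icc 0 T) t) (h0 : 0 ≤ u 0)
    (h : ∀ t ∈ Icc 0 T, u t < 0 → K * u t ≤ u' t) : ∀ t ∈ Icc 0 T, 0 ≤ u t := by
  have key : ∀ ε > 0, ∀ t ∈ Icc 0 T, -u t ≤ ε * Real.exp ((K + 1) * t) := by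
    intro ε hε
    refine image_le_of_deriv_right_lt_deriv_boundary (f := fun t => -u t) (f' := fun t => -u' t)
      (B' := fun t => (K + 1) * (ε * Real.exp ((K + 1) * t)))
      (fun t ht => (hu t ht).continuousWithinAt.neg)
      (fun t ht => ((hu t (Ico_subset_Icc_self ht)).neg).mono_of_mem_nhdsWithin
        (Icc_mem_nhdsGE_of_mem ht)) ?_ (fun t => ?_) (fun t ht hte => ?_)
    · simp only [mul_zero, Real.exp_zero, mul_one]; linarith
    · have := (((hasDerivAt_id t).const_mul (K + 1)).exp).const_mul ε
      refine this.congr_deriv ?_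
      simp only [id]; ring
    · have hpos : 0 < ε * Real.exp ((K + 1) * t) := by positivity
      have := h t (Ico_subset_Icc_self ht) (by linarith)
      rw [← hte] at hpos ⊢
      linarith
  intro t ht
  by_contra hcon
  push Not at hcon
  have := key (-u t / 2 / Real.exp ((K + 1) * t)) (by
    have : 0 < -u t := by linarith
    positivity) t ht
  rw [div_mul_cancel₀ _ (Real.exp_pos _).ne'] at this
  linarith

/-! ### Two-point estimates along solutions -/

theorem IsSolutionOn.mono {E : Type*} [NormedAddCommGroup E] [NormedSpace ℝ E] {v : E → E}
    {S : Set E} {I J : Set ℝ} {z : ℝ → E} (h : IsSolutionOn v S I z) (hJ : J ⊆ I) :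
    IsSolutionOn v S J z :=
  fun t ht => ⟨(h t (hJ ht)).1, (h t (hJ ht)).2.mono hJ⟩

theorem IsSolutionOn.shift {E : Type*} [NormedAddCommGroup E] [NormedSpace ℝ E] {v : E → E}
    {S : Set E} {z : ℝ → E} (h : IsSolutionOn v S (Ici 0) z) {s : ℝ} (hs : 0 ≤ s) :
    IsSolutionOn v S (Ici 0) (fun t => z (t + s)) := by
  intro t ht
  rw [mem_Ici] at ht
  have hts : t + s ∈ Ici (0 : ℝ) := add_nonneg ht hs
  refine ⟨(h _ hts).1, ?_⟩
  have := (h _ hts).2.scomp t ((hasDerivAt_id t).add_const s).hasDerivWithinAt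
    (s := Ici 0) (fun r hr => add_nonneg hr hs)
  simpa [Function.comp_def] using! this

section Cone

variable {A B : Type*} [NormedAddCommGroup A] [InnerProductSpace ℝ A]
  [NormedAddCommGroup B] [InnerProductSpace ℝ B] {f : A × B → A × B} {M α β c : ℝ}
  {L : NNReal} {S : Set (A × B)} {I : Set ℝ} {x y : ℝ → A × B} {t T : ℝ}

theorem HasDerivWithinAt.prod_fst {z : ℝ → A × B} {z' : A × B} (h : HasDerivWithinAt z z' I t) :
    HasDerivWithinAt (fun s => (z s).1) z'.1 I t :=
  (ContinuousLinearMap.fst ℝ A B).hasFDerivAt.comp_hasDerivWithinAt t h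

theorem HasDerivWithinAt.prod_snd {z : ℝ → A × B} {z' : A × B} (h : HasDerivWithinAt z z' I t) :
    HasDerivWithinAt (fun s => (z s).2) z'.2 I t :=
  (ContinuousLinearMap.snd ℝ A B).hasFDerivAt.comp_hasDerivWithinAt t h

theorem IsSolutionOn.hasDerivWithinAt_fst_sub_sq (hx : IsSolutionOn f S I x)
    (hy : IsSolutionOn f S I y) (ht : t ∈ I) :
    HasDerivWithinAt (fun s => ‖(x s).1 - (y s).1‖ ^ 2)
      (2 * inner ℝ ((x t).1 - (y t).1) ((f (x t)).1 - (f (y t)).1)) I t :=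
  ((hx t ht).2.prod_fst.sub (hy t ht).2.prod_fst).norm_sq

theorem IsSolutionOn.hasDerivWithinAt_snd_sub_sq (hx : IsSolutionOn f S I x)
    (hy : IsSolutionOn f S I y) (ht : t ∈ I) :
    HasDerivWithinAt (fun s => ‖(x s).2 - (y s).2‖ ^ 2)
      (2 * inner ℝ ((x t).2 - (y t).2) ((f (x t)).2 - (f (y t)).2)) I t :=
  ((hx t ht).2.prod_snd.sub (hy t ht).2.prod_snd).norm_sq

namespace ConeField

variable (hf : ConeField f M α β c L)
include hf

theorem pos : 0 < M := zero_lt_one.trans hf.one_lt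

theorem zero_isSolutionOn : IsSolutionOn f (unitBlock A B) I (fun _ => 0) := fun t _ =>
  ⟨by simp, by rw [hf.zero]; exact hasDerivWithinAt_const _ _ _⟩

/-- The unstable cone is forward invariant. -/
theorem cone_invariant (hx : IsSolutionOn f (unitBlock A B) (Icc 0 T) x)
    (hy : IsSolutionOn f (unitBlock A B) (Icc 0 T) y)
    (h0 : ‖(x 0).2 - (y 0).2‖ ≤ M * ‖(x 0).1 - (y 0).1‖) :
    ∀ t ∈ Icc 0 T, ‖(x t).2 - (y t).2‖ ≤ M * ‖(x t).1 - (y t).1‖ := by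
  have hM := hf.pos
  have key := nonneg_of_mul_le_deriv (K := 2 * M * β)
    (u := fun t => M ^ 2 * ‖(x t).1 - (y t).1‖ ^ 2 - ‖(x t).2 - (y t).2‖ ^ 2) (T := T)
    (fun t ht => ((hx.hasDerivWithinAt_fst_sub_sq hy ht).const_mul (M ^ 2)).sub
      (hx.hasDerivWithinAt_snd_sub_sq hy ht)) ?_ ?_
  · intro t ht
    have := key t ht
    refine le_of_sq_le_sq ?_ (by positivity)
    nlinarith
  · have := pow_le_pow_left₀ (norm_nonneg _) h0 2
    nlinarith
  · intro t ht hneg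
    have hE := hf.expand _ (hx t ht).1 _ (hy t ht).1
    have hC := hf.contract _ (hx t ht).1 _ (hy t ht).1
    set a := ‖(x t).1 - (y t).1‖
    set b := ‖(x t).2 - (y t).2‖
    have ha : 0 ≤ a := norm_nonneg _
    have hb : 0 ≤ b := norm_nonneg _
    have hab : M * a ≤ b := by
      refine le_of_sq_le_sq ?_ hb
      nlinarith
    have hab' : a ≤ M * b := by nlinarith [hf.one_lt]
    have hC := hC hab'
    have hcb : c * b ^ 2 ≤ 0 := mul_nonpos_of_nonpos_of_nonneg hf.neg.le (sq_nonneg b)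
    have h1 := mul_le_mul_of_nonneg_left hE (sq_nonneg M)
    have h2 : M * β * (M * a * b) ≤ M * β * b ^ 2 := by
      have := hf.nonneg
      have : M * a * b ≤ b ^ 2 := by nlinarith
      gcongr
    have h3 : M ^ 2 * ((M * β) * a ^ 2) ≤ M ^ 2 * (α * a ^ 2) := by
      have := hf.gap.le
      gcongr
    nlinarith

/-- Inside the unstable cone, differences in the first variable grow exponentially. -/
theorem expansion (hx : IsSolutionOn f (unitBlock A B) (Icc 0 T) x)
    (hy : IsSolutionOn f (unitBlock A B) (Icc 0 T) y)
    (h0 : ‖(x 0).2 - (y 0).2‖ ≤ M * ‖(x 0).1 - (y 0).1‖) :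
    ∀ t ∈ Icc 0 T, ‖(x 0).1 - (y 0).1‖ ^ 2 * Real.exp (2 * (α - M * β) * t) ≤
      ‖(x t).1 - (y t).1‖ ^ 2 := by
  have key := nonneg_of_mul_le_deriv (K := 2 * (α - M * β))
    (u := fun t => ‖(x t).1 - (y t).1‖ ^ 2 -
      ‖(x 0).1 - (y 0).1‖ ^ 2 * Real.exp (2 * (α - M * β) * t)) (T := T)
    (fun t ht => (hx.hasDerivWithinAt_fst_sub_sq hy ht).sub
      ((((hasDerivAt_id t).const_mul (2 * (α - M * β))).exp).const_mul
        (‖(x 0).1 - (y 0).1‖ ^ 2)).hasDerivWithinAt) (by simp) ?_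
  · intro t ht
    have := key t ht
    linarith
  · intro t ht _
    have hE := hf.expand _ (hx t ht).1 _ (hy t ht).1
    have hc := hf.cone_invariant hx hy h0 t ht
    have h1 : β * ‖(x t).1 - (y t).1‖ * ‖(x t).2 - (y t).2‖ ≤
        β * ‖(x t).1 - (y t).1‖ * (M * ‖(x t).1 - (y t).1‖) := by
      have := hf.nonneg
      gcongr
    simp only [id]
    linarith

/-- Two solutions staying in the block for all positive times are separated by a stable cone. -/
theorem stable_cone (hx : IsSolutionOn f (unitBlock A B) (Ici 0) x)
    (hy : IsSolutionOn f (unitBlock A B) (Ici 0) y) :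
    M * ‖(x 0).1 - (y 0).1‖ ≤ ‖(x 0).2 - (y 0).2‖ := by
  by_contra! hcon
  have hpos : 0 < ‖(x 0).1 - (y 0).1‖ := by
    have := hf.pos
    have := (norm_nonneg _).trans_lt hcon
    by_contra h
    nlinarith
  have hg : 0 < 2 * (α - M * β) := by linarith [hf.gap]
  have hlim : Tendsto (fun t => ‖(x 0).1 - (y 0).1‖ ^ 2 * Real.exp (2 * (α - M * β) * t)) atTop
      atTop :=
    (Real.tendsto_exp_atTop.comp (tendsto_id.const_mul_atTop hg)).const_mul_atTop (by positivity)
  obtain ⟨t, ht, ht'⟩ := ((eventually_ge_atTop 0).and (hlim.eventually_gt_atTop 4)).exists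
  have h1 := hf.expansion (hx.mono (Icc_subset_Ici_self (a := t)))
    (hy.mono Icc_subset_Ici_self) hcon.le t
    (right_mem_Icc.2 ht)
  have hxt := (hx t ht).1.1
  have hyt := (hy t ht).1.1
  rw [mem_closedBall_zero_iff] at hxt hyt
  have h2 : ‖(x t).1 - (y t).1‖ ≤ 2 := (norm_sub_le _ _).trans (by linarith)
  nlinarith [norm_nonneg ((x t).1 - (y t).1)]

theorem mul_norm_fst_le (hx : IsSolutionOn f (unitBlock A B) (Ici 0) x) (ht : 0 ≤ t) :
    M * ‖(x t).1‖ ≤ ‖(x t).2‖ := by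
  simpa using hf.stable_cone (hx.shift ht) hf.zero_isSolutionOn

theorem tendsto_zero (hx : IsSolutionOn f (unitBlock A B) (Ici 0) x) :
    Tendsto x atTop (𝓝 0) := by
  have hM := hf.one_lt
  have hdecay : ∀ T, 0 ≤ T → ‖(x T).2‖ ^ 2 ≤ ‖(x 0).2‖ ^ 2 * Real.exp (2 * c * T) := by
    intro T hT
    have hx' := hx.mono (Icc_subset_Ici_self (a := T))
    have h0 := hf.zero_isSolutionOn (I := Icc 0 T)
    have key := nonneg_of_mul_le_deriv (K := 2 * c)
      (u := fun t => ‖(x 0).2‖ ^ 2 * Real.exp (2 * c * t) -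
        ‖(x t).2 - (0 : A × B).2‖ ^ 2) (T := T)
      (fun t ht => ((((hasDerivAt_id t).const_mul (2 * c)).exp).const_mul
        (‖(x 0).2‖ ^ 2)).hasDerivWithinAt.sub (hx'.hasDerivWithinAt_snd_sub_sq h0 ht))
        (by simp) ?_ T (right_mem_Icc.2 hT)
    · simp only [Prod.snd_zero, sub_zero] at key
      linarith
    · intro t ht _
      have h1 := hf.mul_norm_fst_le hx ht.1
      have hC := hf.contract _ (hx' t ht).1 _ (h0 t ht).1
      simp only [Prod.snd_zero, Prod.fst_zero, sub_zero, id] at hC ⊢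
      have := hC (by nlinarith [norm_nonneg (x t).1, norm_nonneg (x t).2])
      linarith
  have hexp : Tendsto (fun t => ‖(x 0).2‖ ^ 2 * Real.exp (2 * c * t)) atTop (𝓝 0) := by
    have hc : 2 * c < 0 := by linarith [hf.neg]
    simpa using (Real.tendsto_exp_atBot.comp (tendsto_id.const_mul_atTop_of_neg hc)).const_mul
      (‖(x 0).2‖ ^ 2)
  have hsq : Tendsto (fun t => ‖x t‖ ^ 2) atTop (𝓝 0) := by
    refine squeeze_zero' (Eventually.of_forall fun t => sq_nonneg _) ?_ hexp
    filter_upwards [eventually_ge_atTop 0] with t ht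
    refine le_trans ?_ (hdecay t ht)
    have h1 := hf.mul_norm_fst_le hx ht
    have h2 : ‖x t‖ ≤ ‖(x t).2‖ :=
      norm_prod_le_iff.2 ⟨by nlinarith [norm_nonneg (x t).1], le_rfl⟩
    gcongr
  rw [tendsto_zero_iff_norm_tendsto_zero]
  simpa [Real.sqrt_sq] using hsq.sqrt

end ConeField
end Cone

/-! ### Radial projection onto the unit ball -/

section RadialProj

variable {E : Type*} [NormedAddCommGroup E] [NormedSpace ℝ E]

/-- The radial projection onto the closed unit ball. -/
def radialProj (x : E) : E := (max 1 ‖x‖)⁻¹ • x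

theorem smul_radialProj (x : E) : max 1 ‖x‖ • radialProj x = x := by
  rw [radialProj, smul_inv_smul₀]
  positivity

theorem radialProj_of_norm_le {x : E} (h : ‖x‖ ≤ 1) : radialProj x = x := by
  simp [radialProj, max_eq_left h]

theorem norm_radialProj_of_one_le {x : E} (h : 1 ≤ ‖x‖) : ‖radialProj x‖ = 1 := by
  rw [radialProj, max_eq_right h, norm_smul, norm_inv, norm_norm, inv_mul_cancel₀]
  positivity

theorem norm_radialProj_le (x : E) : ‖radialProj x‖ ≤ 1 := by
  rcases le_total ‖x‖ 1 with h | h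
  · rwa [radialProj_of_norm_le h]
  · exact (norm_radialProj_of_one_le h).le

theorem norm_radialProj_sub_le (x y : E) : ‖radialProj x - radialProj y‖ ≤ 2 * ‖x - y‖ := by
  have hp : (1 : ℝ) ≤ max 1 ‖x‖ := le_max_left _ _
  have hp0 : (0 : ℝ) < max 1 ‖x‖ := by positivity
  have hdec : radialProj x - radialProj y =
      (max 1 ‖x‖)⁻¹ • ((x - y) + (max 1 ‖y‖ - max 1 ‖x‖) • radialProj y) := by
    rw [sub_smul, smul_radialProj, smul_add, smul_sub, smul_sub, inv_smul_smul₀ hp0.ne', radialProj]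
    abel
  have hmax : |max 1 ‖y‖ - max 1 ‖x‖| ≤ ‖x - y‖ := by
    rw [max_comm 1 ‖y‖, max_comm 1 ‖x‖]
    refine (abs_max_sub_max_le_abs ‖y‖ ‖x‖ 1).trans ?_
    rw [norm_sub_rev]
    exact abs_norm_sub_norm_le y x
  rw [hdec, norm_smul, norm_inv, Real.norm_of_nonneg hp0.le]
  have h1 : ‖(x - y) + (max 1 ‖y‖ - max 1 ‖x‖) • radialProj y‖ ≤ 2 * ‖x - y‖ := by
    refine (norm_add_le _ _).trans ?_
    rw [norm_smul, Real.norm_eq_abs]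
    nlinarith [norm_radialProj_le y, norm_nonneg (radialProj y),
      abs_nonneg (max 1 ‖y‖ - max 1 ‖x‖)]
  calc (max 1 ‖x‖)⁻¹ * _ ≤ 1 * (2 * ‖x - y‖) := by
        gcongr
        exact inv_le_one_of_one_le₀ hp
    _ = _ := one_mul _

end RadialProj

/-! ### Flows of bounded Lipschitz vector fields -/

section Flow

variable {E : Type*} [NormedAddCommGroup E] [NormedSpace ℝ E]

/-- `Φ x` is the integral curve of `v` starting at `x`, for every `x`. -/
structure IsFlowOf (Φ : E → ℝ → E) (v : E → E) : Prop where
  zero : ∀ x, Φ x 0 = x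
  deriv : ∀ x t, HasDerivAt (Φ x) (v (Φ x t)) t

theorem exists_isFlowOf [CompleteSpace E] {v : E → E} {K C : NNReal} (hv : LipschitzWith K v)
    (hC : ∀ x, ‖v x‖ ≤ C) : ∃ Φ, IsFlowOf Φ v := by
  have hloc : ∀ (x : E) (n : ℕ), ∃ z : ℝ → E, z 0 = x ∧ ∀ t ∈ Icc (-(n + 1) : ℝ) (n + 1),
      HasDerivWithinAt z (v (z t)) (Icc (-(n + 1) : ℝ) (n + 1)) t := by
    intro x n
    have h0 : (0 : ℝ) ∈ Icc (-(n + 1) : ℝ) (n + 1) := ⟨by linarith, by positivity⟩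
    have hpl : IsPicardLindelof (fun _ => v) ⟨0, h0⟩ x (C * (n + 1)) 0 C K :=
      .of_time_independent (fun y _ => hC y) hv.lipschitzOnWith (by simp)
    exact hpl.exists_eq_forall_mem_Icc_hasDerivWithinAt₀
  choose z hz0 hz using hloc
  have hagree : ∀ x (n m : ℕ), n ≤ m → EqOn (z x n) (z x m) (Icc (-(n + 1) : ℝ) (n + 1)) := by
    intro x n m hnm
    have hnm' : (n : ℝ) ≤ m := by exact_mod_cast hnm
    have hsub : Icc (-(n + 1) : ℝ) (n + 1) ⊆ Icc (-(m + 1) : ℝ) (m + 1) :=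
      Icc_subset_Icc (by linarith) (by linarith)
    refine ODE_solution_unique_of_mem_Icc (v := fun _ => v) (s := fun _ => univ) (K := K)
      (t₀ := 0) (fun _ _ => hv.lipschitzOnWith) ⟨by linarith, by positivity⟩
      (fun t ht => (hz x n t ht).continuousWithinAt)
      (fun t ht => (hz x n t (Ioo_subset_Icc_self ht)).hasDerivAt (Icc_mem_nhds ht.1 ht.2))
      (fun _ _ => mem_univ _)
      (fun t ht => ((hz x m t (hsub ht)).continuousWithinAt).mono hsub)
      (fun t ht => ((hz x m t (hsub (Ioo_subset_Icc_self ht))).mono hsub).hasDerivAt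
        (Icc_mem_nhds ht.1 ht.2)) (fun _ _ => mem_univ _) ?_
    rw [hz0, hz0]
  have hceil : ∀ (x : E) (n : ℕ) (t : ℝ), |t| ≤ n + 1 → z x ⌈|t|⌉₊ t = z x n t := by
    intro x n t ht
    rcases le_total ⌈|t|⌉₊ n with h | h
    · exact hagree x _ _ h (abs_le.1 ((Nat.le_ceil _).trans (by linarith)))
    · exact (hagree x _ _ h (abs_le.1 ht)).symm
  refine ⟨fun x t => z x ⌈|t|⌉₊ t, fun x => by simp [hz0], fun x t => ?_⟩
  have hlt : |t| < (⌈|t|⌉₊ : ℝ) + 1 := (Nat.le_ceil _).trans_lt (lt_add_one _)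
  have hev : ∀ᶠ s in 𝓝 t, z x ⌈|s|⌉₊ s = z x ⌈|t|⌉₊ s := by
    filter_upwards [(continuous_abs.tendsto t).eventually_lt_const hlt] with s hs
    exact hceil x _ s hs.le
  have hab := abs_lt.1 hlt
  exact ((hz x ⌈|t|⌉₊ t ⟨hab.1.le, hab.2.le⟩).hasDerivAt
    (Icc_mem_nhds hab.1 hab.2)).congr_of_eventuallyEq hev

namespace IsFlowOf

variable {Φ : E → ℝ → E} {v : E → E} {K : NNReal} (hΦ : IsFlowOf Φ v)
include hΦ

theorem dist_le (hv : LipschitzWith K v) (x y : E) {t : ℝ} (ht : 0 ≤ t) :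
    dist (Φ x t) (Φ y t) ≤ dist x y * Real.exp (K * t) := by
  have := dist_le_of_trajectories_ODE (v := fun _ => v) (K := K) (a := 0) (b := t) (δ := dist x y)
    (fun _ => hv) (fun s _ => (hΦ.deriv x s).continuousAt.continuousWithinAt)
    (fun s _ => (hΦ.deriv x s).hasDerivWithinAt)
    (fun s _ => (hΦ.deriv y s).continuousAt.continuousWithinAt)
    (fun s _ => (hΦ.deriv y s).hasDerivWithinAt) (by rw [hΦ.zero, hΦ.zero]) t (right_mem_Icc.2 ht)
  simpa using this

theorem continuous_left (hv : LipschitzWith K v) {t : ℝ} (ht : 0 ≤ t) :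
    Continuous (fun x => Φ x t) :=
  (LipschitzWith.of_dist_le_mul (K := ⟨Real.exp (K * t), (Real.exp_pos _).le⟩) fun x y => by
    rw [mul_comm]
    exact hΦ.dist_le hv x y ht).continuous

theorem add (hv : LipschitzWith K v) (x : E) (s t : ℝ) : Φ (Φ x s) t = Φ x (t + s) := by
  have := ODE_solution_unique_univ (v := fun _ => v) (K := K) (s := fun _ => univ) (t₀ := 0)
    (f := Φ (Φ x s)) (g := fun t => Φ x (t + s)) (fun _ => hv.lipschitzOnWith)
    (fun t => ⟨hΦ.deriv _ t, mem_univ _⟩)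
    (fun t => ⟨by
      simpa using! (hΦ.deriv x (t + s)).scomp t ((hasDerivAt_id t).add_const s), mem_univ _⟩)
    (by simp [hΦ.zero])
  exact congrFun this t

theorem norm_sub_self_le {C : ℝ} (hC : ∀ x, ‖v x‖ ≤ C) (x : E) {t : ℝ} (ht : 0 ≤ t) :
    ‖Φ x t - x‖ ≤ C * t := by
  have := norm_image_sub_le_of_norm_deriv_le_segment' (f := Φ x) (a := 0) (b := t) (C := C)
    (fun s _ => (hΦ.deriv x s).hasDerivWithinAt) (fun s _ => hC _) t (right_mem_Icc.2 ht)
  simpa [hΦ.zero] using this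

theorem norm_displacement_sub_le (hv : LipschitzWith K v) (x y : E) {t : ℝ} (ht : 0 ≤ t) :
    ‖(Φ x t - x) - (Φ y t - y)‖ ≤ K * Real.exp (K * t) * t * ‖x - y‖ := by
  have := norm_image_sub_le_of_norm_deriv_le_segment' (f := fun s => Φ x s - Φ y s)
    (f' := fun s => v (Φ x s) - v (Φ y s)) (a := 0) (b := t)
    (C := K * (‖x - y‖ * Real.exp (K * t)))
    (fun s _ => ((hΦ.deriv x s).sub (hΦ.deriv y s)).hasDerivWithinAt) (fun s hs => ?_) t
    (right_mem_Icc.2 ht)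
  · simp only [hΦ.zero, sub_zero] at this
    rw [show Φ x t - x - (Φ y t - y) = Φ x t - Φ y t - (x - y) by abel]
    linarith
  · rw [← dist_eq_norm, ← dist_eq_norm]
    refine (hv.dist_le_mul _ _).trans ?_
    gcongr
    refine (hΦ.dist_le hv x y hs.1).trans ?_
    gcongr
    exact hs.2.le

end IsFlowOf
end Flow

/-! ### The truncated field and the existence of trajectories staying in the block -/

section Truncation

variable {A B : Type*} [NormedAddCommGroup A] [InnerProductSpace ℝ A]
  [NormedAddCommGroup B] [InnerProductSpace ℝ B]

/-- The product of the radial projections onto the unit balls. -/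
def blockProj (z : A × B) : A × B := (radialProj z.1, radialProj z.2)

theorem blockProj_mem (z : A × B) : blockProj z ∈ unitBlock A B :=
  ⟨mem_closedBall_zero_iff.2 (norm_radialProj_le _),
    mem_closedBall_zero_iff.2 (norm_radialProj_le _)⟩

theorem blockProj_of_mem {z : A × B} (hz : z ∈ unitBlock A B) : blockProj z = z :=
  Prod.ext (radialProj_of_norm_le (mem_closedBall_zero_iff.1 hz.1))
    (radialProj_of_norm_le (mem_closedBall_zero_iff.1 hz.2))

theorem lipschitzWith_blockProj : LipschitzWith 2 (blockProj : A × B → A × B) :=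
  LipschitzWith.of_dist_le_mul fun x y => by
    rw [dist_eq_norm, dist_eq_norm]
    refine norm_prod_le_iff.2 ⟨?_, ?_⟩
    · exact (norm_radialProj_sub_le _ _).trans (by gcongr; exacts [le_rfl, norm_fst_le (x - y)])
    · exact (norm_radialProj_sub_le _ _).trans (by gcongr; exacts [le_rfl, norm_snd_le (x - y)])

variable {f : A × B → A × B} {M α β c : ℝ} {L : NNReal}

theorem IsFlowOf.isSolutionOn {Φ : A × B → ℝ → A × B} (hΦ : IsFlowOf Φ (f ∘ blockProj)) {x : A × B}
    {I : Set ℝ} (h : ∀ t ∈ I, Φ x t ∈ unitBlock A B) :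
    IsSolutionOn f (unitBlock A B) I (Φ x) := fun t ht => ⟨h t ht, by
  have := (hΦ.deriv x t).hasDerivWithinAt (s := I)
  rwa [Function.comp_apply, blockProj_of_mem (h t ht)] at this⟩

namespace ConeField

variable (hf : ConeField f M α β c L)
include hf

theorem lipschitzWith_trunc : LipschitzWith (L * 2) (f ∘ blockProj) :=
  lipschitzOnWith_univ.1
    (hf.lip.comp lipschitzWith_blockProj.lipschitzOnWith fun z _ => blockProj_mem z)

theorem norm_trunc_le (z : A × B) : ‖(f ∘ blockProj) z‖ ≤ L := by
  have := hf.lip.dist_le_mul _ (blockProj_mem z) 0 (by simp)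
  rw [hf.zero, dist_zero_right, dist_zero_right] at this
  refine this.trans (mul_le_of_le_one_right L.2 ?_)
  exact norm_prod_le_iff.2 ⟨norm_radialProj_le _, norm_radialProj_le _⟩

theorem inner_trunc_fst_ge {z : A × B} (hz : 1 ≤ ‖z.1‖) :
    α - M * β ≤ inner ℝ z.1 ((f ∘ blockProj) z).1 := by
  have hE := hf.expand _ (blockProj_mem z) 0 (by simp)
  have h1 : ‖(blockProj z).1‖ = 1 := norm_radialProj_of_one_le hz
  have h2 : ‖(blockProj z).2‖ ≤ 1 := norm_radialProj_le _
  have hz' : z.1 = ‖z.1‖ • (blockProj z).1 := by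
    rw [← max_eq_right hz]
    exact (smul_radialProj z.1).symm
  rw [hf.zero] at hE
  simp only [Prod.fst_zero, Prod.snd_zero, sub_zero, h1] at hE
  rw [hz', real_inner_smul_left]
  have hb : β * ‖(blockProj z).2‖ ≤ M * β := by
    have := hf.nonneg
    have := hf.one_lt
    nlinarith
  have := hf.gap
  simp only [Function.comp_apply]
  nlinarith

theorem inner_trunc_snd_nonpos {z : A × B} (hz : 1 ≤ ‖z.2‖) :
    inner ℝ z.2 ((f ∘ blockProj) z).2 ≤ 0 := by
  have hC := hf.contract _ (blockProj_mem z) 0 (by simp)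
  have h1 : ‖(blockProj z).2‖ = 1 := norm_radialProj_of_one_le hz
  have h2 : ‖(blockProj z).1‖ ≤ 1 := norm_radialProj_le _
  have hz' : z.2 = ‖z.2‖ • (blockProj z).2 := by
    rw [← max_eq_right hz]
    exact (smul_radialProj z.2).symm
  rw [hf.zero] at hC
  simp only [Prod.fst_zero, Prod.snd_zero, sub_zero, h1] at hC
  have hC := hC (by linarith [hf.one_lt])
  rw [hz', real_inner_smul_left]
  have := hf.neg
  simp only [Function.comp_apply]
  nlinarith

variable {Φ : A × B → ℝ → A × B} (hΦ : IsFlowOf Φ (f ∘ blockProj))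
include hΦ

theorem norm_flow_snd_le {x : A × B} (hx : ‖x.2‖ ≤ 1) {t : ℝ} (ht : 0 ≤ t) :
    ‖(Φ x t).2‖ ≤ 1 := by
  have key := nonneg_of_mul_le_deriv (K := 0) (T := t) (u := fun s => 1 - ‖(Φ x s).2‖ ^ 2)
    (fun s _ => ((hΦ.deriv x s).hasDerivWithinAt.prod_snd.norm_sq).const_sub 1) ?_ ?_ t
    (right_mem_Icc.2 ht)
  · nlinarith [norm_nonneg (Φ x t).2]
  · simp only [hΦ.zero]
    nlinarith [norm_nonneg x.2]
  · intro s _ hs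
    have := hf.inner_trunc_snd_nonpos (z := Φ x s) (by nlinarith [norm_nonneg (Φ x s).2])
    linarith

theorem one_lt_norm_flow_fst {x : A × B} {s t : ℝ} (hst : s ≤ t) (hs : 1 < ‖(Φ x s).1‖) :
    1 < ‖(Φ x t).1‖ := by
  have key := image_le_of_deriv_right_lt_deriv_boundary (a := s) (b := t)
    (f := fun r => -‖(Φ x r).1‖ ^ 2) (B := fun _ => -‖(Φ x s).1‖ ^ 2) (B' := fun _ => 0)
    (fun r _ => ((hΦ.deriv x r).hasDerivWithinAt.prod_fst.norm_sq).neg.continuousWithinAt)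
    (fun r _ => ((hΦ.deriv x r).hasDerivWithinAt.prod_fst.norm_sq).neg) le_rfl
    (fun r => hasDerivAt_const _ _) (fun r _ hr => ?_) (right_mem_Icc.2 hst)
  · simp only [neg_le_neg_iff] at key
    nlinarith [norm_nonneg (Φ x t).1]
  · simp only [neg_inj] at hr
    have := hf.inner_trunc_fst_ge (z := Φ x r) (by nlinarith [norm_nonneg (Φ x r).1])
    linarith [hf.gap]

theorem flow_mem {x : A × B} (hx : ‖x.2‖ ≤ 1) {t T : ℝ} (h0 : 0 ≤ t) (htT : t ≤ T)
    (hT : ‖(Φ x T).1‖ ≤ 1) : Φ x t ∈ unitBlock A B := by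
  refine ⟨mem_closedBall_zero_iff.2 ?_, mem_closedBall_zero_iff.2 (hf.norm_flow_snd_le hΦ hx h0)⟩
  by_contra! h
  exact absurd hT (not_le.2 (hf.one_lt_norm_flow_fst hΦ htT h))

theorem one_le_inner_flow {x : A × B} (hx : ‖x.1‖ = 1) {τ : ℝ} (hτ : 0 ≤ τ)
    (hτ' : (L * 2) * (L * τ) ≤ α - M * β) : 1 ≤ inner ℝ x.1 (Φ x τ).1 := by
  have key := nonneg_of_mul_le_deriv (K := 0) (T := τ)
    (u := fun s => inner ℝ x.1 (Φ x s).1 - 1)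
    (fun s _ => (HasDerivWithinAt.inner ℝ (hasDerivWithinAt_const _ _ x.1)
      (hΦ.deriv x s).hasDerivWithinAt.prod_fst).sub_const 1) ?_ ?_ τ (right_mem_Icc.2 hτ)
  · linarith
  · simp [hΦ.zero, hx]
  · intro s hs _
    have h1 := hf.inner_trunc_fst_ge (z := x) hx.ge
    have h2 : ‖(f ∘ blockProj) (Φ x s) - (f ∘ blockProj) x‖ ≤ α - M * β := by
      refine (hf.lipschitzWith_trunc.norm_sub_le _ _).trans (le_trans ?_ hτ')
      push_cast
      gcongr
      refine (hΦ.norm_sub_self_le hf.norm_trunc_le x hs.1).trans ?_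
      gcongr
      exact hs.2
    have h3 : -(α - M * β) ≤
        inner ℝ x.1 ((f ∘ blockProj) (Φ x s) - (f ∘ blockProj) x).1 := by
      refine neg_le_of_abs_le ((abs_real_inner_le_norm _ _).trans ?_)
      rw [hx, one_mul]
      exact (norm_fst_le _).trans h2
    rw [Prod.fst_sub, inner_sub_right] at h3
    simp only [inner_zero_left, add_zero, zero_mul]
    linarith

/-- The image of a Lipschitz disk under the flow for a short time covers the unit ball. -/
theorem exists_flow_fst_eq_of_disk [CompleteSpace A] {τ : ℝ} (hτ : 0 ≤ τ)
    (hτ₁ : (L * 2) * (L * τ) ≤ α - M * β)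
    (hτ₂ : (L * 2) * Real.exp ((L * 2) * τ) * τ * M ≤ 1 / 8) {h : A → B}
    (hh : ∀ a a', ‖a‖ ≤ 1 → ‖a'‖ ≤ 1 → ‖h a - h a'‖ ≤ M * ‖a - a'‖) {y : A} (hy : ‖y‖ ≤ 1) :
    ∃ a, ‖a‖ ≤ 1 ∧ (Φ (a, h a) τ).1 = y := by
  set g : A → A := fun a => (Φ (a, h a) τ).1 - a with hg
  have hgl : ∀ a a', ‖a‖ ≤ 1 → ‖a'‖ ≤ 1 → ‖g a - g a'‖ ≤ 1 / 8 * ‖a - a'‖ := by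
    intro a a' ha ha'
    have h1 := hΦ.norm_displacement_sub_le hf.lipschitzWith_trunc (a, h a) (a', h a') hτ
    have h2 : ‖((a, h a) : A × B) - (a', h a')‖ ≤ M * ‖a - a'‖ := by
      refine norm_prod_le_iff.2 ⟨?_, hh a a' ha ha'⟩
      exact le_mul_of_one_le_left (norm_nonneg _) hf.one_lt.le
    refine ((norm_fst_le _).trans h1).trans ?_
    push_cast
    calc _ ≤ L * 2 * Real.exp (L * 2 * τ) * τ * (M * ‖a - a'‖) := by gcongr
      _ = (L * 2 * Real.exp (L * 2 * τ) * τ * M) * ‖a - a'‖ := by ring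
      _ ≤ _ := by gcongr
  have hcon : ContractingWith (1 / 2) (fun a => radialProj (y - g (radialProj a))) := by
    refine ⟨by rw [← NNReal.coe_lt_coe]; norm_num, LipschitzWith.of_dist_le_mul fun a a' => ?_⟩
    rw [dist_eq_norm, dist_eq_norm]
    have h1 := norm_radialProj_sub_le (y - g (radialProj a)) (y - g (radialProj a'))
    have h2 := hgl _ _ (norm_radialProj_le a) (norm_radialProj_le a')
    have h3 := norm_radialProj_sub_le a a'
    rw [sub_sub_sub_cancel_left, norm_sub_rev (g _)] at h1
    push_cast
    linarith
  have hfix : radialProj (y - g (radialProj hcon.fixedPoint)) = hcon.fixedPoint :=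
    hcon.fixedPoint_isFixedPt
  set a := hcon.fixedPoint
  have ha : ‖a‖ ≤ 1 := hfix ▸ norm_radialProj_le _
  rw [radialProj_of_norm_le ha] at hfix
  refine ⟨a, ha, ?_⟩
  rcases le_or_gt ‖y - g a‖ 1 with hr | hr
  · rw [radialProj_of_norm_le hr] at hfix
    have : (Φ (a, h a) τ).1 = g a + a := by simp [hg]
    rw [this]
    nth_rewrite 2 [← hfix]
    abel
  · exfalso
    have ha1 : ‖a‖ = 1 := hfix ▸ norm_radialProj_of_one_le hr.le
    have hsm := smul_radialProj (y - g a)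
    rw [hfix, max_eq_right hr.le] at hsm
    have h1 := hf.one_le_inner_flow hΦ (x := (a, h a)) ha1 hτ hτ₁
    have h2 : (Φ (a, h a) τ).1 = y - ‖y - g a‖ • a + a := by
      rw [hsm, hg]
      simp
    simp only at h1
    rw [h2, inner_add_right, inner_sub_right, real_inner_smul_right, real_inner_self_eq_norm_sq,
      ha1] at h1
    have h3 : inner ℝ a y ≤ 1 := (real_inner_le_norm _ _).trans (by rw [ha1, one_mul]; exact hy)
    linarith

theorem exists_flow_fst_eq [CompleteSpace A] {τ : ℝ} (hτ : 0 ≤ τ)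
    (hτ₁ : (L * 2) * (L * τ) ≤ α - M * β)
    (hτ₂ : (L * 2) * Real.exp ((L * 2) * τ) * τ * M ≤ 1 / 8) {b : B} (hb : ‖b‖ ≤ 1) (n : ℕ) :
    ∀ y : A, ‖y‖ ≤ 1 → ∃ a, ‖a‖ ≤ 1 ∧ (Φ (a, b) (n * τ)).1 = y := by
  induction n with
  | zero => exact fun y hy => ⟨y, hy, by simp [hΦ.zero]⟩
  | succ n ih =>
    intro y hy
    choose! s hs hs' using ih
    have hn : 0 ≤ n * τ := by positivity
    have hsol : ∀ y, ‖y‖ ≤ 1 →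
        IsSolutionOn f (unitBlock A B) (Icc 0 (n * τ)) (Φ (s y, b)) := fun y hy =>
      hΦ.isSolutionOn fun t ht =>
        hf.flow_mem hΦ hb ht.1 ht.2 (by rw [hs' y hy]; exact hy)
    obtain ⟨a, ha, ha'⟩ := hf.exists_flow_fst_eq_of_disk hΦ hτ hτ₁ hτ₂
      (h := fun y => (Φ (s y, b) (n * τ)).2) (fun y y' hy hy' => by
        have := hf.cone_invariant (hsol y hy) (hsol y' hy') (by
          simp only [hΦ.zero, sub_self, norm_zero]
          exact mul_nonneg hf.pos.le (norm_nonneg _)) _ (right_mem_Icc.2 hn)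
        rwa [hs' y hy, hs' y' hy'] at this) hy
    refine ⟨s a, hs a ha, ?_⟩
    have he : (a, (Φ (s a, b) (n * τ)).2) = Φ (s a, b) (n * τ) := Prod.ext (hs' a ha).symm rfl
    rw [he, hΦ.add hf.lipschitzWith_trunc] at ha'
    rw [← ha']
    push_cast
    ring_nf

theorem exists_flow_mem [ProperSpace A] {b : B} (hb : ‖b‖ ≤ 1) :
    ∃ a : A, ‖a‖ ≤ 1 ∧ ∀ t ∈ Ici (0 : ℝ), Φ (a, b) t ∈ unitBlock A B := by
  obtain ⟨τ, hτ₁, hτ₂, hτ⟩ : ∃ τ : ℝ, (L * 2) * (L * τ) ≤ α - M * β ∧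
      (L * 2) * Real.exp ((L * 2) * τ) * τ * M ≤ 1 / 8 ∧ 0 < τ := by
    have h1 : Tendsto (fun τ : ℝ => (L * 2) * (L * τ)) (𝓝[>] 0) (𝓝 ((L * 2) * (L * (0 : ℝ)))) :=
      (Continuous.tendsto (by fun_prop) _).mono_left nhdsWithin_le_nhds
    have h2 : Tendsto (fun τ : ℝ => (L * 2) * Real.exp ((L * 2) * τ) * τ * M) (𝓝[>] 0)
        (𝓝 ((L * 2) * Real.exp ((L * 2) * 0) * 0 * M)) :=
      (Continuous.tendsto (by fun_prop) _).mono_left nhdsWithin_le_nhds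
    have e1 := h1.eventually_le_const (u := α - M * β) (by simpa using hf.gap)
    have e2 := h2.eventually_le_const (u := 1 / 8) (by simp)
    obtain ⟨τ, h⟩ := (e1.and (e2.and self_mem_nhdsWithin)).exists
    exact ⟨τ, h.1, h.2.1, h.2.2⟩
  set D : ℕ → Set A := fun n => Metric.closedBall 0 1 ∩ {a | ‖(Φ (a, b) (n * τ)).1‖ ≤ 1}
  have hclosed : ∀ n, IsClosed (D n) := fun n =>
    Metric.isClosed_closedBall.inter (isClosed_le (by
      have := hΦ.continuous_left hf.lipschitzWith_trunc (t := n * τ) (by positivity)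
      fun_prop) continuous_const)
  obtain ⟨a, ha⟩ := IsCompact.nonempty_iInter_of_sequence_nonempty_isCompact_isClosed D
    (fun n a ha => ⟨ha.1, by
      have := hf.flow_mem hΦ (x := (a, b)) hb (t := n * τ) (by positivity)
        (by push_cast; nlinarith) ha.2
      exact mem_closedBall_zero_iff.1 this.1⟩)
    (fun n => by
      obtain ⟨a, ha, ha'⟩ := hf.exists_flow_fst_eq hΦ hτ.le hτ₁ hτ₂ hb n 0 (by simp)
      exact ⟨a, mem_closedBall_zero_iff.2 ha, by simp [ha']⟩)
    ((isCompact_closedBall _ _).inter_right (isClosed_le (by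
      have := hΦ.continuous_left hf.lipschitzWith_trunc (t := (0 : ℕ) * τ) (by positivity)
      fun_prop) continuous_const)) hclosed
  rw [mem_iInter] at ha
  refine ⟨a, mem_closedBall_zero_iff.1 (ha 0).1, fun t ht => ?_⟩
  obtain ⟨n, hn⟩ := exists_nat_ge (t / τ)
  exact hf.flow_mem hΦ hb ht ((div_le_iff₀ hτ).1 hn) (ha n).2

omit hΦ in
/-- The stable manifold of the origin is a Lipschitz graph over the second variable. -/
theorem exists_stableManifold_eq_graph [ProperSpace A] [CompleteSpace B] :
    ∃ σ : B → A, MapsTo σ (Metric.closedBall 0 1) (Metric.closedBall 0 1) ∧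
      (∀ b ∈ Metric.closedBall (0 : B) 1, ∀ b' ∈ Metric.closedBall (0 : B) 1,
        M * ‖σ b - σ b'‖ ≤ ‖b - b'‖) ∧
      stableManifold f (unitBlock A B) 0 = (fun b => (σ b, b)) '' Metric.closedBall 0 1 := by
  obtain ⟨Φ, hΦ⟩ := exists_isFlowOf hf.lipschitzWith_trunc hf.norm_trunc_le
  have hex : ∀ b : B, ‖b‖ ≤ 1 → ∃ a : A, ‖a‖ ≤ 1 ∧
      IsSolutionOn f (unitBlock A B) (Ici 0) (Φ (a, b)) := fun b hb =>
    (hf.exists_flow_mem hΦ hb).imp fun a ha => ⟨ha.1, hΦ.isSolutionOn ha.2⟩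
  choose! σ hσ hsol using hex
  simp only [MapsTo, mem_closedBall_zero_iff]
  refine ⟨σ, fun b => hσ b, fun b hb b' hb' => ?_, Subset.antisymm ?_ ?_⟩
  · simpa [hΦ.zero] using hf.stable_cone (hsol b hb) (hsol b' hb')
  · rintro y ⟨z, rfl, hz, -⟩
    have hb : ‖(z 0).2‖ ≤ 1 := mem_closedBall_zero_iff.1 (hz 0 self_mem_Ici).1.2
    refine ⟨(z 0).2, mem_closedBall_zero_iff.2 hb, Prod.ext ?_ rfl⟩
    have := hf.stable_cone (hsol _ hb) hz
    simp only [hΦ.zero, sub_self, norm_zero] at this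
    have h0 := nonpos_of_mul_nonpos_right this hf.pos
    exact sub_eq_zero.1 (norm_le_zero_iff.1 h0)
  · rintro _ ⟨b, hb, rfl⟩
    have := hsol b (mem_closedBall_zero_iff.1 hb)
    exact ⟨_, hΦ.zero _, this, hf.tendsto_zero this⟩

end ConeField
end Truncation

/-! ### The Lyapunov estimate on a Lipschitz graph -/

section Lyapunov

variable {A B : Type*} [NormedAddCommGroup A] [InnerProductSpace ℝ A]
  [NormedAddCommGroup B] [InnerProductSpace ℝ B]

/-- The derivative of the first component of a curve moving in a stable cone is controlled by the
derivative of the second one. -/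
theorem norm_deriv_fst_le_of_cone {z : ℝ → A × B} {z' : A × B} {I : Set ℝ} {t M : ℝ}
    (hI : UniqueDiffWithinAt ℝ I t) (hz : HasDerivWithinAt z z' I t)
    (h : ∀ s ∈ I, M * ‖(z s).1 - (z t).1‖ ≤ ‖(z s).2 - (z t).2‖) : M * ‖z'.1‖ ≤ ‖z'.2‖ := by
  have h1 := (hasDerivWithinAt_iff_tendsto_slope.1 hz.prod_fst).norm.const_mul M
  have h2 := (hasDerivWithinAt_iff_tendsto_slope.1 hz.prod_snd).norm
  have : (𝓝[I \ {t}] t).NeBot := accPt_principal_iff_nhdsWithin.1 hI.accPt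
  refine le_of_tendsto_of_tendsto h1 h2 ?_
  filter_upwards [self_mem_nhdsWithin] with s hs
  simp only [slope, vsub_eq_sub, norm_smul]
  have := mul_le_mul_of_nonneg_left (h s hs.1) (norm_nonneg (s - t)⁻¹)
  linarith

end Lyapunov

section Main

variable {nu ns k : ℕ} {K : Set (Eucl k)} {fa : Eucl nu × Eucl ns × Eucl k → Eucl nu}
  {fb : Eucl nu × Eucl ns × Eucl k → Eucl ns} {M : ℝ} {μ : Eucl k}

/-- Along trajectories in a stable manifold which is a graph with slope at most `1 / M`, the
function `lyapS` has a derivative bounded by `2 C ‖b‖²`, for every bound `C` of the rate. -/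
theorem exists_hasDerivWithinAt_lyapS (hdb : ∀ p ∈ hsetParam nu ns K, DifferentiableAt ℝ fb p)
    (hμ : μ ∈ K) (heq : fieldAt fa fb μ 0 = 0) (hM : 0 < M) {σ : Eucl ns → Eucl nu}
    {S : Set (Eucl nu × Eucl ns)} (hSN : S ⊆ hset nu ns) (h0 : 0 ∈ S)
    (hS : ∀ z ∈ S, σ z.2 = z.1)
    (hcone : ∀ z ∈ S, ∀ w ∈ S, M * ‖z.1 - w.1‖ ≤ ‖z.2 - w.2‖)
    {t₁ t₂ : ℝ} {z : ℝ → Eucl nu × Eucl ns} (h12 : t₁ < t₂)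
    (hz : IsSolutionOn (fieldAt fa fb μ) S (Icc t₁ t₂) z) {t : ℝ} (ht : t ∈ Icc t₁ t₂) :
    ∃ d : ℝ, HasDerivWithinAt (fun s => lyapS σ (z s)) d (Icc t₁ t₂) t ∧
      ∀ C : ℝ, rateSW fb K M ≤ C → 1 / 2 * d ≤ C * ‖(z t).2‖ ^ 2 := by
  obtain ⟨htS, htd⟩ := hz t ht
  set v := fieldAt fa fb μ (z t) with hv
  refine ⟨2 * inner ℝ (z t).1 v.1 + 2 * inner ℝ (z t).2 v.2, ?_, fun C hC => ?_⟩
  · refine (htd.prod_fst.norm_sq.add htd.prod_snd.norm_sq).congr_of_mem (fun s hs => ?_) ht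
    simp [lyapS, hS _ (hz s hs).1]
  have hz1 : M * ‖(z t).1‖ ≤ ‖(z t).2‖ := by simpa using hcone _ htS _ h0
  have hv1 : M * ‖v.1‖ ≤ ‖v.2‖ :=
    norm_deriv_fst_le_of_cone (uniqueDiffOn_Icc h12 t ht) htd
      fun s hs => hcone _ (hz s hs).1 _ htS
  have hin : inner ℝ (z t).1 v.1 ≤ 1 / M ^ 2 * (‖(z t).2‖ * ‖v.2‖) := by
    refine (real_inner_le_norm _ _).trans ?_
    rw [one_div, ← div_eq_inv_mul, le_div_iff₀ (by positivity)]
    calc ‖(z t).1‖ * ‖v.1‖ * M ^ 2 = (M * ‖(z t).1‖) * (M * ‖v.1‖) := by ring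
      _ ≤ _ := by gcongr
  have hW := inner_add_inner_le_of_rateSW_le hdb hμ heq hM hC (hSN htS) hz1
    (w := (‖(z t).2‖ / ‖v.2‖) • v.2) (by
      rw [norm_smul, norm_div, norm_norm, norm_norm]
      rcases eq_or_ne ‖v.2‖ 0 with h | h
      · simp [h]
      · rw [div_mul_cancel₀ _ h])
  rw [← hv, real_inner_smul_left, real_inner_self_eq_norm_sq] at hW
  have hid : ‖(z t).2‖ / ‖v.2‖ * ‖v.2‖ ^ 2 = ‖(z t).2‖ * ‖v.2‖ := by
    rcases eq_or_ne ‖v.2‖ 0 with h | h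
    · simp [h]
    · field_simp
  rw [hid] at hW
  linarith

end Main

end

theorem proposition3p9 {nu ns k : ℕ}
    (U : Set (Eucl nu × Eucl ns × Eucl k)) (hU : IsOpen U)
    (fa : Eucl nu × Eucl ns × Eucl k → Eucl nu) (hfa : ContDiffOn ℝ ∞ fa U)
    (fb : Eucl nu × Eucl ns × Eucl k → Eucl ns) (hfb : ContDiffOn ℝ ∞ fb U)
    (K : Set (Eucl k)) (hK : IsCompact K) (hNK : hsetParam nu ns K ⊆ U)
    (heq : ∀ μ ∈ K, fieldAt fa fb μ 0 = 0)
    (hblock : ∀ μ ∈ K,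
      IsIsolatingBlock (fieldAt fa fb μ) {z | (z.1, z.2, μ) ∈ U} (hset nu ns))
    (M : ℝ) (hcone : ConeCondition fa fb K M)
    (hrate : rateSW fb K M < 0) :
    ∀ μ ∈ K, ∃ σ : Eucl ns → Eucl nu,
      MapsTo σ (Metric.closedBall 0 1) (Metric.closedBall 0 1) ∧
      (∃ C, LipschitzOnWith C σ (Metric.closedBall 0 1)) ∧
      stableManifold (fieldAt fa fb μ) (hset nu ns) 0 =
        (fun b => (σ b, b)) '' Metric.closedBall 0 1 ∧
      IsLyapunovOn (fieldAt fa fb μ) (lyapS σ)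
        (stableManifold (fieldAt fa fb μ) (hset nu ns) 0) 0 ∧
      DecaysOn (fieldAt fa fb μ) (lyapS σ)
        (stableManifold (fieldAt fa fb μ) (hset nu ns) 0)
        (M ^ 2 / (M ^ 2 + 1) * (rateSW fb K M).toReal) := by
  intro μ hμ
  have hM : 0 < M := zero_lt_one.trans hcone.one_lt
  have hdb : ∀ p ∈ hsetParam nu ns K, DifferentiableAt ℝ fb p := fun p hp =>
    (hfb.contDiffAt (hU.mem_nhds (hNK hp))).differentiableAt (by simp)
  obtain ⟨α, β, c, L, hf⟩ := hcone.exists_coneField hU hfa hfb hNK hμ (heq μ hμ)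
  obtain ⟨σ, hσ, hlip, hgraph⟩ := hf.exists_stableManifold_eq_graph
  change stableManifold _ (hset nu ns) 0 = _ at hgraph
  set S := stableManifold (fieldAt fa fb μ) (hset nu ns) 0 with hSdef
  have hS : ∀ z ∈ S, σ z.2 = z.1 := by
    intro z hz
    rw [hgraph] at hz
    obtain ⟨b, -, rfl⟩ := hz
    rfl
  have hSN : S ⊆ hset nu ns := by
    rw [hgraph]
    rintro _ ⟨b, hb, rfl⟩
    exact ⟨hσ hb, hb⟩
  have h0 : (0 : Eucl nu × Eucl ns) ∈ S :=
    ⟨fun _ => 0, rfl, hf.zero_isSolutionOn, tendsto_const_nhds⟩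
  have hSc : ∀ z ∈ S, ∀ w ∈ S, M * ‖z.1 - w.1‖ ≤ ‖z.2 - w.2‖ := by
    intro z hz w hw
    rw [← hS z hz, ← hS w hw]
    exact hlip _ (hSN hz).2 _ (hSN hw).2
  have hS0 : ∀ z ∈ S, M * ‖z.1‖ ≤ ‖z.2‖ := fun z hz => by simpa using hSc z hz 0 h0
  refine ⟨σ, hσ, ⟨(1 / M).toNNReal, LipschitzOnWith.of_dist_le_mul fun b hb b' hb' => ?_⟩,
    hgraph, fun t₁ t₂ z h12 hz t ht => ?_, fun t₁ t₂ z h12 hz t ht => ?_⟩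
  · rw [dist_eq_norm, dist_eq_norm, Real.coe_toNNReal _ (by positivity), one_div, ← div_eq_inv_mul, le_div_iff₀' hM]
    exact hlip b hb b' hb'
  · obtain ⟨d, hd, hdC⟩ :=
      exists_hasDerivWithinAt_lyapS hdb hμ (heq μ hμ) hM hSN h0 hS hSc h12 hz ht
    obtain ⟨C, hC1, hC2⟩ := EReal.lt_iff_exists_real_btwn.1 hrate
    have hC : C < 0 := by exact_mod_cast hC2
    have hle := hdC C hC1.le
    refine ⟨d, hd, by nlinarith [sq_nonneg ‖(z t).2‖], fun hd0 => ?_⟩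
    have hb : ‖(z t).2‖ = 0 := by
      rw [hd0, mul_zero] at hle
      exact pow_eq_zero_iff two_ne_zero |>.1
        (le_antisymm (nonpos_of_mul_nonneg_right hle hC) (sq_nonneg _))
    have ha : ‖(z t).1‖ = 0 := by
      have := hS0 _ (hz t ht).1
      rw [hb] at this
      exact le_antisymm (nonpos_of_mul_nonpos_right this hM) (norm_nonneg _)
    exact Prod.ext (norm_eq_zero.1 ha) (norm_eq_zero.1 hb)
  · obtain ⟨d, hd, hdC⟩ :=
      exists_hasDerivWithinAt_lyapS hdb hμ (heq μ hμ) hM hSN h0 hS hSc h12 hz ht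
    refine ⟨d, hd, ?_⟩
    have hle := hdC (rateSW fb K M).toReal (EReal.le_coe_toReal (hrate.trans_le le_top).ne)
    have hC : (rateSW fb K M).toReal ≤ 0 := EReal.toReal_nonpos hrate.le
    refine hle.trans ?_
    have hL : M ^ 2 / (M ^ 2 + 1) * lyapS σ (z t) ≤ ‖(z t).2‖ ^ 2 := by
      rw [div_mul_eq_mul_div, div_le_iff₀ (by positivity), lyapS, hS _ (hz t ht).1]
      have := pow_le_pow_left₀ (by positivity) (hS0 _ (hz t ht).1) 2
      nlinarith
    nlinarith
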